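/- Let $n,m$ be integers with $1<m<n/2$ and let $p,q\in(0,1)$. For $x\in\{0,1\}^n$ let $\|x\|_1$ be its number of ones, and let $\mathrm{Jump}_m(x)=m+\|x\|_1$ if $\|x\|_1\in[0..n-m]\cup\{n\}$ and $\mathrm{Jump}_m(x)=n-\|x\|_1$ otherwise. The Markov move-acceptance hyper-heuristic (MMAHH) with the operators OI (only improving) and AM (all moves), maximizing $f=\mathrm{Jump}_m$, starts with $x_0$ uniformly random in $\{0,1\}^n$ and $s_0=\mathrm{OI}$. In iteration $t$ it flips one uniformly random bit of $x_t$ to get $x'$; it sets $x_{t+1}=x'$ if $s_t=\mathrm{AM}$, or if $s_t=\mathrm{OI}$ and $f(x')>f(x_t)$, and $x_{t+1}=x_t$ otherwise. Independently of this, if $s_t=\mathrm{OI}$ then $s_{t+1}=\mathrm{AM}$ with probability $p$ and $s_{t+1}=\mathrm{OI}$ otherwise, and if $s_t=\mathrm{AM}$ then $s_{t+1}=\mathrm{OI}$ with probability $q$ and $s_{t+1}=\mathrm{AM}$ otherwise. Let $T=\inf\{t\ge 0\mid x_t=(1,\dots,1)\}$ be its runtime. There is an absolute constant hidden in the $O$-notation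 such that, for all such $n,m,p,q$ with \[ \frac{m}{2(n-2m)}\Bigl(q+\frac4n\Bigr)\ge p, \] we have \[ \mathrm{E}[T]=O\Bigl((1+pn)\Bigl(\frac1p+\frac1q\Bigr)\Bigl(n+\frac{n^m}{(m-1)!\,(1-q)^{m-2}}\Bigr)\Bigr). \] The condition on $p,q$ is satisfied whenever $\frac{m}{2n}q\ge p$. In particular, with implicit constants that depend only on $c$ in (1) and only on $c,d$ in (2): 1. If $q=\frac12$ and $p=\frac{m}{cn}q$ for some real $c\ge2$, then \[ \mathrm{E}[T]=O\Bigl(n^2+\frac{2^{m-2}n^{m+1}}{(m-1)!}\Bigr)=O(n^{m+1}). \] 2. If $q=\frac1{dm}$ and $p=\frac{m}{cn}q$ for some reals $c\ge2$ and $d\ge1$, then \[ \mathrm{E}[T]=O\Bigl(n^2+\frac{e^{1/d}\,n^{m+1}}{(m-1)!}\Bigr)=O\Bigl(\frac{n^{m+1}}{(m-1)!}\Bigr). \] -/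

import Mathlib

open MeasureTheory ProbabilityTheory
open scoped ENNReal Nat

namespace MMAHH

/-- Bit-strings of length `n`. -/
abbrev BitString (n : ℕ) : Type := Fin n → Bool

/-- `‖x‖₁`, the number of one-bits of `x`. -/
def numOnes {n : ℕ} (x : BitString n) : ℕ :=
  (Finset.univ.filter fun i => x i = true).card

/-- The all-ones string `x* = (1, …, 1)`. -/
def allOnes (n : ℕ) : BitString n := fun _ => true

/-- The benchmark `Jump_m` on bit-strings of length `n` (to be maximized). -/
noncomputable def jump (n m : ℕ) (x : BitString n) : ℝ :=
  if numOnes x + m ≤ n ∨ numOnes x = n then (m : ℝ) + numOnes x else (n : ℝ) - numOnes x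

/-- The two move-acceptance operators: only-improving and all-moves. -/
inductive AccOp : Type
  | OI
  | AM
  deriving DecidableEq

instance : Fintype AccOp := ⟨{AccOp.OI, AccOp.AM}, fun s => by cases s <;> decide⟩

instance : MeasurableSpace AccOp := ⊤

instance : DiscreteMeasurableSpace AccOp := ⟨fun _ => trivial⟩

/-- States of the algorithm: current bit-string and current acceptance operator. -/
abbrev State (n : ℕ) : Type := BitString n × AccOp

/-- The string `x` with bit `i` flipped. -/
def flipBit {n : ℕ} (x : BitString n) (i : Fin n) : BitString n :=
  Function.update x i (!x i)

/-- The next search point when the operator `s` judges the offspring `x'` of `x`. -/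
noncomputable def accept {n : ℕ} (f : BitString n → ℝ) :
    AccOp → BitString n → BitString n → BitString n
  | AccOp.OI, x, x' => if f x < f x' then x' else x
  | AccOp.AM, _, x' => x'

/-- One step of the operator chain: `OI` switches to `AM` with probability `p` and stays with
probability `1 - p`; `AM` switches to `OI` with probability `q` and stays with probability
`1 - q`. (`bernoulliMeasure a b r` gives mass `r` to `a` and mass `1 - r` to `b`.) -/
noncomputable def switch (p q : unitInterval) : AccOp → Measure AccOp
  | AccOp.OI => bernoulliMeasure AccOp.AM AccOp.OI p
  | AccOp.AM => bernoulliMeasure AccOp.OI AccOp.AM q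

instance (p q : unitInterval) (s : AccOp) : IsProbabilityMeasure (switch p q s) := by
  cases s <;> (unfold switch; infer_instance)

/-- One iteration of the algorithm: a uniformly random bit is flipped and the offspring is judged
by the current operator; independently, the operator is updated by the two-state chain. -/
noncomputable def stepKernel {n : ℕ} [NeZero n] (f : BitString n → ℝ) (p q : unitInterval) :
    Kernel (State n) (State n) :=
  Kernel.ofFunOfCountable fun z =>
    ((PMF.uniformOfFintype (Fin n)).map fun i => accept f z.2 z.1 (flipBit z.1 i)).toMeasure.prod
      (switch p q z.2)

instance {n : ℕ} [NeZero n] (f : BitString n → ℝ) (p q : unitInterval) :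
    IsMarkovKernel (stepKernel f p q) :=
  ⟨fun z => by
    change IsProbabilityMeasure (((PMF.uniformOfFintype (Fin n)).map
      fun i => accept f z.2 z.1 (flipBit z.1 i)).toMeasure.prod (switch p q z.2))
    infer_instance⟩

/-- The initial distribution: a uniformly random bit-string, and the operator `OI`. -/
noncomputable def initial (n : ℕ) : Measure (State n) :=
  (PMF.uniformOfFintype (BitString n)).toMeasure.prod (Measure.dirac AccOp.OI)

instance (n : ℕ) : IsProbabilityMeasure (initial n) := by
  unfold initial; infer_instance

/-- The law of the whole run `((x₀, s₀), (x₁, s₁), …)` of the algorithm on `f`: the time-homogeneous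
Markov chain with the above initial distribution and transition kernel. -/
noncomputable def law {n : ℕ} [NeZero n] (f : BitString n → ℝ) (p q : unitInterval) :
    Measure (ℕ → State n) :=
  Kernel.trajMeasure (X := fun _ => State n) (initial n) fun t =>
    (stepKernel f p q).comap (fun h => h ⟨t, Finset.mem_Iic.2 le_rfl⟩) (measurable_pi_apply _)

/-- The runtime `T = inf {t ≥ 0 | x_t = x*}` of a run (`∞` if `x*` is never reached). -/
noncomputable def runtime {n : ℕ} (ω : ℕ → State n) : ℝ≥0∞ :=
  ⨅ (t : ℕ) (_ : (ω t).1 = allOnes n), (t : ℝ≥0∞)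

/-- The expected runtime `E[T]` of the algorithm on `Jump_m`. -/
noncomputable def expectedRuntime (n m : ℕ) [NeZero n] (p q : unitInterval) : ℝ≥0∞ :=
  ∫⁻ ω, runtime ω ∂(law (jump n m) p q)

end MMAHH

/-! Only the number d of zeros and the operator matter: acceptance depends on them and on whether
the flipped bit is a zero or a one. `OI` descends for d > m, is stuck at the local optimum d = m,
and climbs back to it for 1 < d < m; from d = 1 it also accepts the optimum. Crossing the valley
thus relies on `AM`.

The proof is one application of additive drift, to Φ = R + K(1 - D). Here R is `returnPotential`,
which drops by at least one in expectation everywhere except at (m, `AM`), where it vanishes and one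
step brings it to at most m + a + β + 1/p on average. D is `descentProb`, a lower bound for the
chance of a direct descent: it is subharmonic, so -D never hurts, and at (m, `AM`) it rises on
average from 0 to at least ρ = m!/n^m (1-q)^(m-2). Taking K = (m + a + β + 1/p + 1)/ρ pays for the
one bad state. In effect, each departure from (m, `AM`) costs one return time and succeeds with
probability at least ρ.

Above the local optimum R is linear in d - m, with slope a for `OI` and slope α and offset β for
`AM`. `AM` drifts away from d = m while d < n/2, and `OI` must recover that loss. The hypothesis on
p and q is what makes the linear drift conditions solvable (`expectedRuntime_le_of_linear`,
`expectedRuntime_le_general`). -/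

namespace MMAHH

/-! ### Additive drift for Markov chains -/

/-- The law of the time-homogeneous Markov chain with transition kernel `κ` started in `μ`. -/
noncomputable abbrev chainLaw {X : Type*} [MeasurableSpace X] (μ : Measure X) (κ : Kernel X X)
    [IsProbabilityMeasure μ] [IsMarkovKernel κ] : Measure (ℕ → X) :=
  Kernel.trajMeasure (X := fun _ => X) μ fun t =>
    κ.comap (fun h : (i : Finset.Iic t) → X => h ⟨t, Finset.mem_Iic.2 le_rfl⟩)
      (measurable_pi_apply _)

/-- The indicator of the event that the path has avoided `A` up to time `t`. -/
noncomputable def alive {X : Type*} (A : Set X) (t : ℕ) (ω : ℕ → X) : ℝ≥0∞ :=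
  open Classical in if ∀ s ≤ t, ω s ∉ A then 1 else 0

lemma measurable_alive {X : Type*} [MeasurableSpace X] {A : Set X} (hA : MeasurableSet A) (t : ℕ) :
    Measurable (alive A t) := by
  have : {ω : ℕ → X | ∀ s ≤ t, ω s ∉ A} = ⋂ s ∈ Set.Iic t, (fun ω : ℕ → X => ω s) ⁻¹' Aᶜ := by
    ext; simp
  refine Measurable.ite ?_ measurable_const measurable_const
  rw [this]
  exact MeasurableSet.biInter (Set.to_countable _) fun s _ => measurable_pi_apply s hA.compl

/-- Each time before the first visit to `A` contributes 1 to the sum; if there is no visit, the sum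
diverges. -/
lemma hittingTime_le_tsum_alive {X : Type*} (A : Set X) (ω : ℕ → X) :
    ⨅ (t : ℕ) (_ : ω t ∈ A), (t : ℝ≥0∞) ≤ ∑' t, alive A t ω := by
  classical
  by_cases h : ∃ t, ω t ∈ A
  · refine (iInf₂_le (Nat.find h) (Nat.find_spec h)).trans ?_
    calc ((Nat.find h : ℕ) : ℝ≥0∞) = ∑ t ∈ Finset.range (Nat.find h), alive A t ω := by
          rw [Finset.sum_congr rfl (g := fun _ => 1)]
          · simp
          · intro t ht
            exact if_pos fun s hs => Nat.find_min h (hs.trans_lt (Finset.mem_range.1 ht))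
      _ ≤ _ := ENNReal.sum_le_tsum _
  · push Not at h
    have : ∀ t, alive A t ω = 1 := fun t => if_pos fun s _ => h s
    simp [this]

/-- One step of the chain: the potential drops on average by at least one while `A` is avoided. -/
lemma lintegral_alive_succ_add_le {X : Type*} [MeasurableSpace X] (μ : Measure X) (κ : Kernel X X)
    [IsProbabilityMeasure μ] [IsMarkovKernel κ] {A : Set X} (hA : MeasurableSet A)
    {G : X → ℝ≥0∞} (hG : Measurable G) (hdrift : ∀ z ∉ A, 1 + ∫⁻ z', G z' ∂κ z ≤ G z) (t : ℕ) :
    ∫⁻ ω, alive A t ω ∂chainLaw μ κ + ∫⁻ ω, alive A (t + 1) ω * G (ω (t + 1)) ∂chainLaw μ κ ≤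
      ∫⁻ ω, alive A t ω * G (ω t) ∂chainLaw μ κ := by
  let S : Set ((i : Finset.Iic t) → X) := {h | ∀ i, h i ∉ A}
  have hS : MeasurableSet S := by
    have : S = ⋂ i, (fun h : (i : Finset.Iic t) → X => h i) ⁻¹' Aᶜ := by ext; simp [S]
    rw [this]
    exact MeasurableSet.iInter fun i => measurable_pi_apply i hA.compl
  let g : ((i : Finset.Iic t) → X) → ℝ≥0∞ := S.indicator 1
  have hg : Measurable g := measurable_one.indicator hS
  have hga : ∀ ω : ℕ → X, alive A t ω = g (Preorder.frestrictLe t ω) := by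
    intro ω
    have : Preorder.frestrictLe (π := fun _ => X) t ω ∈ S ↔ ∀ s ≤ t, ω s ∉ A := by simp [S]
    by_cases h : ∀ s ≤ t, ω s ∉ A
    · simp only [alive, g, if_pos h]
      exact (Set.indicator_of_mem (this.2 h) 1).symm
    · simp only [alive, g, if_neg h]
      exact (Set.indicator_of_notMem (fun h' => h (this.1 h')) 1).symm
  let last : ((i : Finset.Iic t) → X) → X := fun h => h ⟨t, Finset.mem_Iic.2 le_rfl⟩
  have hlast : Measurable last := measurable_pi_apply _
  let ν := (chainLaw μ κ).map (Preorder.frestrictLe t)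
  have hr : Measurable (Preorder.frestrictLe (π := fun _ : ℕ => X) t) := by fun_prop
  have hpair : Measurable fun ω : ℕ → X =>
      (Preorder.frestrictLe (π := fun _ => X) t ω, ω (t + 1)) := by
    fun_prop
  have key : ∫⁻ ω, alive A t ω * G (ω (t + 1)) ∂chainLaw μ κ =
      ∫⁻ h, g h * ∫⁻ z, G z ∂κ (last h) ∂ν := by
    -- Markov property: the joint law of the history up to t and the next state is the history law
    -- composed with κ at the last state.
    have h1 := Kernel.map_frestrictLe_trajMeasure_compProd_eq_map_trajMeasure (X := fun _ => X)
      (μ₀ := μ) (κ := fun t => κ.comap (fun h : (i : Finset.Iic t) → X =>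
        h ⟨t, Finset.mem_Iic.2 le_rfl⟩) (measurable_pi_apply _)) (a := t)
    have hm : Measurable fun y : ((i : Finset.Iic t) → X) × X => g y.1 * G y.2 := by fun_prop
    calc ∫⁻ ω, alive A t ω * G (ω (t + 1)) ∂chainLaw μ κ
        = ∫⁻ y, g y.1 * G y.2 ∂(chainLaw μ κ).map
            (fun ω => (Preorder.frestrictLe (π := fun _ => X) t ω, ω (t + 1))) := by
          rw [lintegral_map hm hpair]
          simp only [hga]
      _ = _ := by
          rw [← h1, Measure.lintegral_compProd hm]
          refine lintegral_congr fun h => ?_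
          exact lintegral_const_mul (g h) hG
  have hmono : ∀ ω : ℕ → X, alive A (t + 1) ω ≤ alive A t ω := by
    intro ω
    by_cases h : ∀ s ≤ t, ω s ∉ A
    · simp only [alive, if_pos h]
      split_ifs <;> simp
    · have hsucc : ¬∀ s ≤ t + 1, ω s ∉ A := fun h' => h fun s hs => h' s (hs.trans t.le_succ)
      simp [alive, if_neg h, if_neg hsucc]
  calc ∫⁻ ω, alive A t ω ∂chainLaw μ κ + ∫⁻ ω, alive A (t + 1) ω * G (ω (t + 1)) ∂chainLaw μ κ
      ≤ ∫⁻ ω, alive A t ω ∂chainLaw μ κ + ∫⁻ ω, alive A t ω * G (ω (t + 1)) ∂chainLaw μ κ := by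
        gcongr with ω
        exact hmono ω
    _ = ∫⁻ h, g h ∂ν + ∫⁻ h, g h * ∫⁻ z, G z ∂κ (last h) ∂ν := by
        rw [key, lintegral_map hg hr]
        simp only [hga]
    _ = ∫⁻ h, (g h + g h * ∫⁻ z, G z ∂κ (last h)) ∂ν := by rw [lintegral_add_left hg]
    _ ≤ ∫⁻ h, g h * G (last h) ∂ν := by
        refine lintegral_mono fun h => ?_
        by_cases hh : h ∈ S
        · simpa [g, hh] using hdrift (last h) (hh _)
        · simp [g, hh]
    _ = ∫⁻ ω, alive A t ω * G (ω t) ∂chainLaw μ κ := by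
        have := lintegral_map (μ := chainLaw μ κ) (hg.mul (hG.comp hlast)) hr
        simp only [hga]
        exact this

/-- Additive drift: a bounded potential dropping on average by at least one in each step outside
`A` bounds the expected hitting time of `A`. -/
theorem lintegral_hittingTime_le {X : Type*} [MeasurableSpace X] (μ : Measure X) (κ : Kernel X X)
    [IsProbabilityMeasure μ] [IsMarkovKernel κ] {A : Set X} (hA : MeasurableSet A)
    {G : X → ℝ≥0∞} (hG : Measurable G) (hdrift : ∀ z ∉ A, 1 + ∫⁻ z', G z' ∂κ z ≤ G z)
    {B : ℝ≥0∞} (hB : ∀ z, G z ≤ B) :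
    ∫⁻ ω, ⨅ (t : ℕ) (_ : ω t ∈ A), (t : ℝ≥0∞) ∂chainLaw μ κ ≤ B := by
  -- Telescoped drift. The bound B is needed only for the initial state; working in `ℝ≥0∞` makes
  -- integrability and the sign of the remainder automatic.
  have hsum : ∀ N, ∑ t ∈ Finset.range N, ∫⁻ ω, alive A t ω ∂chainLaw μ κ +
      ∫⁻ ω, alive A N ω * G (ω N) ∂chainLaw μ κ ≤ B := by
    intro N
    induction N with
    | zero =>
      simp only [Finset.range_zero, Finset.sum_empty, zero_add]
      calc ∫⁻ ω, alive A 0 ω * G (ω 0) ∂chainLaw μ κ ≤ ∫⁻ _, 1 * B ∂chainLaw μ κ := by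
            gcongr with ω
            · unfold alive; split_ifs <;> simp
            · exact hB _
        _ = B := by simp
    | succ N ih =>
      rw [Finset.sum_range_succ, add_assoc]
      exact (add_le_add_right (lintegral_alive_succ_add_le μ κ hA hG hdrift N) _).trans ih
  calc ∫⁻ ω, ⨅ (t : ℕ) (_ : ω t ∈ A), (t : ℝ≥0∞) ∂chainLaw μ κ
      ≤ ∫⁻ ω, ∑' t, alive A t ω ∂chainLaw μ κ :=
        lintegral_mono fun ω => hittingTime_le_tsum_alive A ω
    _ = ∑' t, ∫⁻ ω, alive A t ω ∂chainLaw μ κ :=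
        lintegral_tsum fun t => (measurable_alive hA t).aemeasurable
    _ ≤ B := ENNReal.tsum_le_of_sum_range_le fun N => le_self_add.trans (hsum N)

/-! ### Reduction to the number of zeros -/

/-- The number of zero-bits of `x`, that is, its Hamming distance from the all-ones string. -/
def numZeros {n : ℕ} (x : BitString n) : ℕ :=
  (Finset.univ.filter fun i => x i = false).card

lemma numOnes_add_numZeros {n : ℕ} (x : BitString n) : numOnes x + numZeros x = n := by
  have := Finset.card_filter_add_card_filter_not (s := (Finset.univ : Finset (Fin n)))
    (fun i => x i = true)
  simpa [numOnes, numZeros] using this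

lemma numZeros_eq_zero_iff {n : ℕ} {x : BitString n} : numZeros x = 0 ↔ x = allOnes n := by
  simp [numZeros, Finset.filter_eq_empty_iff, funext_iff, allOnes]

lemma numZeros_flipBit_of_false {n : ℕ} {x : BitString n} {i : Fin n} (h : x i = false) :
    numZeros (flipBit x i) + 1 = numZeros x := by
  have : (Finset.univ.filter fun j => flipBit x i j = false) =
      (Finset.univ.filter fun j => x j = false).erase i := by
    ext j
    by_cases hj : j = i <;> simp [flipBit, Function.update_apply, hj, h]
  rw [numZeros, this, Finset.card_erase_add_one (by simp [h]), numZeros]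

lemma numZeros_flipBit_of_true {n : ℕ} {x : BitString n} {i : Fin n} (h : x i = true) :
    numZeros (flipBit x i) = numZeros x + 1 := by
  have : (Finset.univ.filter fun j => flipBit x i j = false) =
      insert i (Finset.univ.filter fun j => x j = false) := by
    ext j
    by_cases hj : j = i <;> simp [flipBit, Function.update_apply, hj, h]
  rw [numZeros, this, Finset.card_insert_of_notMem (by simp [h]), numZeros]

/-- The number of zeros after flipping a zero-bit of a string with `d` zeros. -/
def levelDown (m : ℕ) : AccOp → ℕ → ℕ
  | AccOp.OI, d => if m < d ∨ d = 1 then d - 1 else d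
  | AccOp.AM, d => d - 1

/-- The number of zeros after flipping a one-bit of a string with `d` zeros. -/
def levelUp (m : ℕ) : AccOp → ℕ → ℕ
  | AccOp.OI, d => if d < m then d + 1 else d
  | AccOp.AM, d => d + 1

/-- In terms of the distance d to the optimum, the fitness decreases in d for d ≥ m and increases in
d on the valley 0 < d < m. This yields the case distinctions in `levelDown` and `levelUp`. -/
lemma jump_eq {n m : ℕ} (x : BitString n) :
    jump n m x = if m ≤ numZeros x ∨ numZeros x = 0 then (m : ℝ) + n - numZeros x
      else numZeros x := by
  have h := numOnes_add_numZeros x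
  have hR : (numOnes x : ℝ) + numZeros x = n := by exact_mod_cast h
  have hiff : (numOnes x + m ≤ n ∨ numOnes x = n) ↔ (m ≤ numZeros x ∨ numZeros x = 0) := by omega
  rw [jump]
  simp only [hiff]
  split_ifs <;> linarith

lemma numZeros_accept_of_false {n m : ℕ} (hm : 1 < m) (hmn : 2 * m < n) (s : AccOp)
    {x : BitString n} {i : Fin n} (h : x i = false) :
    numZeros (accept (jump n m) s x (flipBit x i)) = levelDown m s (numZeros x) := by
  have hz := numZeros_flipBit_of_false h
  cases s with
  | AM => simp only [accept, levelDown]; omega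
  | OI =>
    simp only [accept, levelDown]
    have hc : jump n m x < jump n m (flipBit x i) ↔ (m < numZeros x ∨ numZeros x = 1) := by
      have hzR : (numZeros (flipBit x i) : ℝ) + 1 = numZeros x := by exact_mod_cast hz
      have hmn' : 2 * (m : ℝ) < n := by exact_mod_cast hmn
      rw [jump_eq, jump_eq]
      split_ifs with h1 h2 h2
      · have : m < numZeros x ∨ numZeros x = 1 := by omega
        simp only [this, iff_true]; linarith
      · have h3 : numZeros x = m := by omega
        have h3R : (numZeros x : ℝ) = m := by exact_mod_cast h3
        have : ¬(m < numZeros x ∨ numZeros x = 1) := by omega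
        simp only [this, iff_false]; linarith
      · have h3 : numZeros x = 1 := by omega
        have h3R : (numZeros x : ℝ) = 1 := by exact_mod_cast h3
        have hm' : (1 : ℝ) < m := by exact_mod_cast hm
        simp only [h3, or_true, iff_true]; push_cast; linarith
      · have : ¬(m < numZeros x ∨ numZeros x = 1) := by omega
        simp only [this, iff_false]; linarith
    by_cases hcase : m < numZeros x ∨ numZeros x = 1
    · rw [if_pos (hc.2 hcase), if_pos hcase]; omega
    · rw [if_neg (mt hc.1 hcase), if_neg hcase]

lemma numZeros_accept_of_true {n m : ℕ} (hmn : 2 * m < n) (s : AccOp)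
    {x : BitString n} (hx : 0 < numZeros x) {i : Fin n} (h : x i = true) :
    numZeros (accept (jump n m) s x (flipBit x i)) = levelUp m s (numZeros x) := by
  have hz := numZeros_flipBit_of_true h
  cases s with
  | AM => simp only [accept, levelUp]; omega
  | OI =>
    simp only [accept, levelUp]
    have hc : jump n m x < jump n m (flipBit x i) ↔ numZeros x < m := by
      have hzR : (numZeros (flipBit x i) : ℝ) = numZeros x + 1 := by exact_mod_cast hz
      have hmn' : 2 * (m : ℝ) < n := by exact_mod_cast hmn
      rw [jump_eq, jump_eq]
      split_ifs with h1 h2 h2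
      · have : ¬ numZeros x < m := by omega
        simp only [this, iff_false]; linarith
      · omega
      · have h3 : numZeros x + 1 = m := by omega
        have h3R : (numZeros x : ℝ) + 1 = m := by exact_mod_cast h3
        have : numZeros x < m := by omega
        simp only [this, iff_true]; linarith
      · have : numZeros x < m := by omega
        simp only [this, iff_true]; linarith
    by_cases hcase : numZeros x < m
    · rw [if_pos (hc.2 hcase), if_pos hcase]; omega
    · rw [if_neg (mt hc.1 hcase), if_neg hcase]

/-! ### One-step means and the drift criterion on levels -/

/-- The expectation of `F` under one step of the operator chain started in `s`. -/
noncomputable def opMean (p q : ℝ) (F : AccOp → ℝ) : AccOp → ℝ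
  | AccOp.OI => p * F AccOp.AM + (1 - p) * F AccOp.OI
  | AccOp.AM => q * F AccOp.OI + (1 - q) * F AccOp.AM

/-- The expectation after one iteration of a function of the number of zeros and the operator. -/
noncomputable def levelMean (n m : ℕ) (p q : ℝ) (F : ℕ → AccOp → ℝ) (d : ℕ) (s : AccOp) : ℝ :=
  (d : ℝ) / n * opMean p q (F (levelDown m s d)) s +
    ((n : ℝ) - d) / n * opMean p q (F (levelUp m s d)) s

lemma opMean_nonneg (p q : unitInterval) {F : AccOp → ℝ} (hF : ∀ s, 0 ≤ F s) (s : AccOp) :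
    0 ≤ opMean p q F s := by
  have h1 := p.2.1
  have h2 := sub_nonneg.2 p.2.2
  have h3 := q.2.1
  have h4 := sub_nonneg.2 q.2.2
  cases s <;> exact add_nonneg (mul_nonneg (by assumption) (hF _))
    (mul_nonneg (by assumption) (hF _))

lemma lintegral_switch (p q : unitInterval) {F : AccOp → ℝ} (hF : ∀ s, 0 ≤ F s) (s : AccOp) :
    ∫⁻ s', ENNReal.ofReal (F s') ∂switch p q s = ENNReal.ofReal (opMean p q F s) := by
  have key : ∀ (r : unitInterval) (a b : AccOp),
      ∫⁻ s', ENNReal.ofReal (F s') ∂bernoulliMeasure a b r =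
        ENNReal.ofReal (r * F a + (1 - r) * F b) := by
    intro r a b
    have hr := r.2.1
    have hr' := r.2.2
    rw [bernoulliMeasure_def, lintegral_add_measure, lintegral_smul_measure,
      lintegral_smul_measure, lintegral_dirac, lintegral_dirac,
      ENNReal.ofReal_add (mul_nonneg hr (hF a)) (mul_nonneg (by linarith) (hF b)),
      ENNReal.ofReal_mul hr, ENNReal.ofReal_mul (by linarith)]
    congr 2
    · rw [Real.toNNReal_of_nonneg hr]; rfl
    · rw [Real.toNNReal_of_nonneg (by linarith)]; rfl
  cases s <;> exact key _ _ _

/-- The step measure is a product, since the operator update is independent of the flipped bit;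
Tonelli separates the two averages. Acceptance uses the old operator `z.2`. -/
lemma lintegral_stepKernel {n : ℕ} [NeZero n] (f : BitString n → ℝ) (p q : unitInterval)
    {F : State n → ℝ} (hF : ∀ z, 0 ≤ F z) (z : State n) :
    ∫⁻ z', ENNReal.ofReal (F z') ∂stepKernel f p q z =
      ENNReal.ofReal (1 / n * ∑ i, opMean p q
        (fun s => F (accept f z.2 z.1 (flipBit z.1 i), s)) z.2) := by
  have hn : (0 : ℝ) < n := by exact_mod_cast Nat.pos_of_ne_zero (NeZero.ne n)
  change ∫⁻ z', ENNReal.ofReal (F z') ∂(((PMF.uniformOfFintype (Fin n)).map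
      fun i => accept f z.2 z.1 (flipBit z.1 i)).toMeasure.prod (switch p q z.2)) = _
  rw [lintegral_prod _ (by fun_prop)]
  simp only [fun x => lintegral_switch p q (F := fun s => F (x, s)) (fun s => hF (x, s)) z.2]
  rw [← PMF.toMeasure_map _ _ (by fun_prop), lintegral_map (measurable_of_countable _) (by fun_prop),
    lintegral_fintype, Finset.mul_sum, ENNReal.ofReal_sum_of_nonneg
      (fun i _ => mul_nonneg (by positivity) (opMean_nonneg p q (fun _ => hF _) _))]
  refine Finset.sum_congr rfl fun i _ => ?_
  rw [PMF.toMeasure_apply_singleton _ _ (MeasurableSet.singleton _), PMF.uniformOfFintype_apply,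
    ENNReal.ofReal_mul (by positivity), mul_comm, one_div, ENNReal.ofReal_inv_of_pos hn]
  simp

/-- Lumpability: all zero-bits lead to one level and all one-bits to another, with weights d/n and
(n-d)/n. -/
lemma sum_opMean_accept {n m : ℕ} (hm : 1 < m) (hmn : 2 * m < n) (p q : ℝ)
    (Φ : ℕ → AccOp → ℝ) {x : BitString n} (hx : 0 < numZeros x) (s : AccOp) :
    1 / (n : ℝ) * ∑ i, opMean p q
      (fun s' => Φ (numZeros (accept (jump n m) s x (flipBit x i))) s') s =
      levelMean n m p q Φ (numZeros x) s := by
  have h0 : ∀ i, opMean p q (fun s' => Φ (numZeros (accept (jump n m) s x (flipBit x i))) s') s =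
      if x i = false then opMean p q (Φ (levelDown m s (numZeros x))) s
        else opMean p q (Φ (levelUp m s (numZeros x))) s := by
    intro i
    by_cases h : x i = false
    · rw [numZeros_accept_of_false hm hmn s h, if_pos h]
    · rw [numZeros_accept_of_true hmn s hx (by simpa using h), if_neg h]
  have hones : ((Finset.univ.filter fun i => ¬x i = false).card : ℝ) = n - numZeros x := by
    have h1 : (Finset.univ.filter fun i => ¬x i = false).card = numOnes x := by simp [numOnes]
    have h2 : (numOnes x : ℝ) + numZeros x = n := by exact_mod_cast numOnes_add_numZeros x
    rw [h1]; linarith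
  simp only [h0]
  rw [Finset.sum_ite, Finset.sum_const, Finset.sum_const, nsmul_eq_mul, nsmul_eq_mul, hones,
    levelMean, numZeros]
  ring

/-- A potential of the number of zeros and the operator dropping on average by one in each
iteration bounds the expected runtime. -/
theorem expectedRuntime_le {n m : ℕ} [NeZero n] (hm : 1 < m) (hmn : 2 * m < n)
    (p q : unitInterval) {Φ : ℕ → AccOp → ℝ} (hΦ : ∀ d s, 0 ≤ Φ d s)
    (hdrift : ∀ d s, 0 < d → d ≤ n → 1 + levelMean n m p q Φ d s ≤ Φ d s)
    {B : ℝ} (hB : ∀ d s, d ≤ n → Φ d s ≤ B) :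
    expectedRuntime n m p q ≤ ENNReal.ofReal B := by
  have hle : ∀ x : BitString n, numZeros x ≤ n := fun x => by
    have := numOnes_add_numZeros x; omega
  -- `law` and `runtime` unfold to `chainLaw` and to the hitting time of the states carrying the
  -- all-ones string.
  refine lintegral_hittingTime_le (initial n) (stepKernel (jump n m) p q)
    (A := {z : State n | z.1 = allOnes n}) (Set.to_countable _).measurableSet
    (G := fun z => ENNReal.ofReal (Φ (numZeros z.1) z.2)) (by fun_prop) ?_
    fun z => ENNReal.ofReal_le_ofReal (hB _ _ (hle _))
  intro z hz
  have hz' : 0 < numZeros z.1 := Nat.pos_of_ne_zero fun h => hz (numZeros_eq_zero_iff.1 h)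
  rw [lintegral_stepKernel (jump n m) p q (F := fun z => Φ (numZeros z.1) z.2)
    (fun z => hΦ _ _) z, sum_opMean_accept hm hmn p q Φ hz' z.2, ← ENNReal.ofReal_one]
  have h : 0 ≤ levelMean n m p q Φ (numZeros z.1) z.2 := by
    rw [← sum_opMean_accept hm hmn p q Φ hz' z.2]
    exact mul_nonneg (by positivity)
      (Finset.sum_nonneg fun i _ => opMean_nonneg p q (fun s => hΦ _ s) z.2)
  rw [← ENNReal.ofReal_add zero_le_one h]
  exact ENNReal.ofReal_le_ofReal (hdrift _ _ hz' (hle _))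

/-! ### The return potential -/

/-- A potential measuring the time to reach the local optimum with operator `AM`. Above the
local optimum it is linear in the number of zeros for either operator. -/
noncomputable def returnPotential (m : ℕ) (p a α β : ℝ) (d : ℕ) (s : AccOp) : ℝ :=
  if d = 0 then 0
  else if d < m then ((m : ℝ) * (m + 1) - d * (d + 1)) / 2 + 1 / p
  else match s with
    | AccOp.OI => a * (d - m) + 1 / p
    | AccOp.AM => if d = m then 0 else α * (d - m) + β + 1 / p

/-- A lower bound for the probability of descending from `d` zeros straight to the optimum. -/
noncomputable def descentProb (n m : ℕ) (q : ℝ) (d : ℕ) : AccOp → ℝ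
  | AccOp.OI => if d = 0 then 1 else if d = 1 then 1 / (n : ℝ) else 0
  | AccOp.AM => if d < m then (d ! : ℝ) / (n : ℝ) ^ d * (1 - q) ^ (d - 2) else 0

section returnPotential

variable {n m : ℕ} {p q a α β : ℝ}

lemma returnPotential_zero (s : AccOp) : returnPotential m p a α β 0 s = 0 := by
  simp [returnPotential]

lemma returnPotential_of_lt {d : ℕ} (h0 : 0 < d) (h : d < m) (s : AccOp) :
    returnPotential m p a α β d s = ((m : ℝ) * (m + 1) - d * (d + 1)) / 2 + 1 / p := by
  simp [returnPotential, h0.ne', h]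

lemma returnPotential_OI {d : ℕ} (h0 : 0 < d) (h : m ≤ d) :
    returnPotential m p a α β d AccOp.OI = a * (d - m) + 1 / p := by
  rw [returnPotential, if_neg h0.ne', if_neg h.not_gt]

lemma returnPotential_AM_self : returnPotential m p a α β m AccOp.AM = 0 := by
  simp [returnPotential]

lemma returnPotential_AM {d : ℕ} (h : m < d) :
    returnPotential m p a α β d AccOp.AM = α * (d - m) + β + 1 / p := by
  rw [returnPotential, if_neg (by omega), if_neg (by omega)]
  simp [h.ne']

/-- The exceptional value 0 at (m, `AM`) lies below the linear formula, so a step down to m needs no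
separate case. -/
lemma returnPotential_AM_le {d : ℕ} (hp : 0 < p) (hβ : 0 ≤ β) (h0 : 0 < d) (h : m ≤ d) :
    returnPotential m p a α β d AccOp.AM ≤ α * (d - m) + β + 1 / p := by
  rcases h.eq_or_lt with rfl | h
  · rw [returnPotential_AM_self, sub_self, mul_zero, zero_add]; positivity
  · rw [returnPotential_AM h]

lemma returnPotential_le_of_le {d : ℕ} (hp : 0 < p) (h0 : 0 < d) (h : d ≤ m) (s : AccOp) :
    returnPotential m p a α β d s ≤ ((m : ℝ) * (m + 1) - d * (d + 1)) / 2 + 1 / p := by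
  rcases h.eq_or_lt with rfl | h
  · rw [sub_self, zero_div, zero_add]
    cases s
    · rw [returnPotential_OI h0 le_rfl]; simp
    · rw [returnPotential_AM_self]; positivity
  · rw [returnPotential_of_lt h0 h]

lemma opMean_le {F : AccOp → ℝ} {b : ℝ} (hp : 0 ≤ p) (hp1 : p ≤ 1) (hq : 0 ≤ q) (hq1 : q ≤ 1)
    (hF : ∀ s, F s ≤ b) (s : AccOp) : opMean p q F s ≤ b := by
  cases s <;> simp only [opMean] <;> nlinarith [hF AccOp.OI, hF AccOp.AM]

lemma returnPotential_nonneg (hp : 0 < p) (ha : 0 ≤ a) (hα : 0 ≤ α) (hβ : 0 ≤ β) (d : ℕ)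
    (s : AccOp) : 0 ≤ returnPotential m p a α β d s := by
  rcases Nat.eq_zero_or_pos d with rfl | h0
  · rw [returnPotential_zero]
  rcases lt_trichotomy d m with h | rfl | h
  · rw [returnPotential_of_lt h0 h]
    have h' : (d : ℝ) ≤ m := by exact_mod_cast h.le
    have : (d : ℝ) * (d + 1) ≤ m * (m + 1) := by gcongr
    have : 0 < 1 / p := by positivity
    linarith
  · cases s
    · rw [returnPotential_OI h0 le_rfl]; simp [hp.le]
    · rw [returnPotential_AM_self]
  · have h' : (0 : ℝ) ≤ d - m := by rw [sub_nonneg]; exact_mod_cast h.le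
    cases s
    · rw [returnPotential_OI h0 h.le]; positivity
    · rw [returnPotential_AM h]; positivity

/-- Below the local optimum both operators push the search point back. -/
lemma levelMean_returnPotential_of_lt (hmn : 2 * m < n) (hp : 0 < p) (hp1 : p < 1) (hq : 0 < q)
    (hq1 : q < 1) {d : ℕ} (h0 : 0 < d) (h : d < m) (s : AccOp) :
    1 + levelMean n m p q (returnPotential m p a α β) d s ≤ returnPotential m p a α β d s := by
  have hdn : 2 * (d : ℝ) + 3 ≤ n := by exact_mod_cast (by omega : 2 * d + 3 ≤ n)
  have hd1 : (1 : ℝ) ≤ d := by exact_mod_cast h0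
  have hn : (0 : ℝ) < n := by linarith
  rw [returnPotential_of_lt h0 h]
  have hop : ∀ d' : ℕ, 0 < d' → d' ≤ m →
      opMean p q (returnPotential m p a α β d') s ≤
        ((m : ℝ) * (m + 1) - d' * (d' + 1)) / 2 + 1 / p := fun d' h0' h' =>
    opMean_le hp.le hp1.le hq.le hq1.le (returnPotential_le_of_le hp h0' h') s
  have hup : levelUp m s d = d + 1 := by cases s <;> simp [levelUp, h]
  have hc1 : 0 ≤ (d : ℝ) / n := by positivity
  have hc2 : 0 ≤ ((n : ℝ) - d) / n := div_nonneg (by linarith) hn.le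
  have hu := mul_le_mul_of_nonneg_left (hop (d + 1) (by omega) (by omega)) hc2
  have hdown : opMean p q (returnPotential m p a α β (levelDown m s d)) s ≤
      ((m : ℝ) * (m + 1) - d * (d - 1)) / 2 + 1 / p := by
    have hcase : levelDown m s d = 0 ∨ levelDown m s d = d ∨
        (levelDown m s d = d - 1 ∧ 0 < d - 1) := by
      cases s with
      | OI => simp only [levelDown]; split_ifs <;> omega
      | AM =>
        have : levelDown m AccOp.AM d = d - 1 := rfl
        omega
    have hmd : (d : ℝ) * (d - 1) ≤ m * (m + 1) := by
      have h' : (d : ℝ) ≤ m := by exact_mod_cast h.le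
      nlinarith
    have hp' : 0 < 1 / p := by positivity
    rcases hcase with h1 | h1 | ⟨h1, h2⟩
    · rw [h1]
      refine opMean_le hp.le hp1.le hq.le hq1.le (fun s => ?_) s
      rw [returnPotential_zero]; linarith
    · rw [h1]
      refine (hop d h0 h.le).trans ?_
      linarith
    · rw [h1]
      refine (hop (d - 1) h2 (by omega)).trans (le_of_eq ?_)
      rw [Nat.cast_sub h0]; push_cast; ring
  have hdn' := mul_le_mul_of_nonneg_left hdown hc1
  rw [levelMean, hup]
  push_cast at hu
  -- The quadratic grows in value by d + 1 when passing from d + 1 zeros to d. Hence the mean drop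
  -- is ((n-d)(d+1) - d²)/n = 1 + d(n-2d-1)/n, which is at least 1 since 2d + 3 ≤ n.
  have key : 1 + (d : ℝ) / n * (((m : ℝ) * (m + 1) - d * (d - 1)) / 2 + 1 / p) +
      ((n : ℝ) - d) / n * (((m : ℝ) * (m + 1) - (d + 1) * (d + 1 + 1)) / 2 + 1 / p) =
      ((m : ℝ) * (m + 1) - d * (d + 1)) / 2 + 1 / p - d * (n - 2 * d - 1) / n := by
    field_simp
    ring
  have : 0 ≤ (d : ℝ) * (n - 2 * d - 1) / n := by
    apply div_nonneg _ hn.le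
    nlinarith
  linarith

/-- At the local optimum, operator `OI` only waits for the switch to `AM`. -/
lemma levelMean_returnPotential_self_OI (hm : 1 < m) (hmn : 2 * m < n) (hp : 0 < p) :
    1 + levelMean n m p q (returnPotential m p a α β) m AccOp.OI ≤
      returnPotential m p a α β m AccOp.OI := by
  have hn : (0 : ℝ) < n := by exact_mod_cast (by omega : 0 < n)
  have h1 : levelDown m AccOp.OI m = m := by simp [levelDown]; omega
  have h2 : levelUp m AccOp.OI m = m := by simp [levelUp]
  rw [levelMean, h1, h2, opMean, returnPotential_AM_self,
    returnPotential_OI (by omega) le_rfl]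
  apply le_of_eq
  field_simp
  ring

/-- The cost of one departure from the local optimum. -/
lemma levelMean_returnPotential_self_AM (hm : 1 < m) (hmn : 2 * m < n) (hp : 0 < p) (hp1 : p < 1)
    (hq : 0 < q) (hq1 : q < 1) (ha : 0 ≤ a) (hαa : α ≤ a) (hβ : 0 ≤ β) :
    levelMean n m p q (returnPotential m p a α β) m AccOp.AM ≤ m + a + β + 1 / p := by
  have hn : (0 : ℝ) < n := by exact_mod_cast (by omega : 0 < n)
  have hmn' : (m : ℝ) ≤ n := by exact_mod_cast (by omega : m ≤ n)
  have hm0 : (0 : ℝ) ≤ m := by positivity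
  have hdown : opMean p q (returnPotential m p a α β (m - 1)) AccOp.AM ≤ m + a + β + 1 / p := by
    refine opMean_le hp.le hp1.le hq.le hq1.le (fun s => ?_) _
    rw [returnPotential_of_lt (by omega) (by omega), Nat.cast_sub (by omega)]
    push_cast
    nlinarith
  have hup : opMean p q (returnPotential m p a α β (m + 1)) AccOp.AM ≤ m + a + β + 1 / p := by
    refine opMean_le hp.le hp1.le hq.le hq1.le (fun s => ?_) _
    cases s
    · rw [returnPotential_OI (by omega) (by omega)]; push_cast; linarith
    · rw [returnPotential_AM (by omega)]; push_cast; linarith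
  have hc1 : 0 ≤ (m : ℝ) / n := by positivity
  have hc2 : 0 ≤ ((n : ℝ) - m) / n := div_nonneg (by linarith) hn.le
  have h1 := mul_le_mul_of_nonneg_left hdown hc1
  have h2 := mul_le_mul_of_nonneg_left hup hc2
  have h3 : (m : ℝ) / n * (m + a + β + 1 / p) + ((n : ℝ) - m) / n * (m + a + β + 1 / p) =
      m + a + β + 1 / p := by field_simp; ring
  rw [levelMean, levelDown, levelUp]
  linarith

/-- Above the local optimum, operator `OI` moves downwards. -/
lemma levelMean_returnPotential_OI_of_gt (hp : 0 < p) (ha : 0 ≤ a) (hαa : α ≤ a) (hβ : 0 ≤ β)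
    (hOI : 1 + p * β ≤ a * (m + 1) / n) {d : ℕ} (hd : m < d) (hdn : d ≤ n) (hm : 0 < m) :
    1 + levelMean n m p q (returnPotential m p a α β) d AccOp.OI ≤
      returnPotential m p a α β d AccOp.OI := by
  have hn : (0 : ℝ) < n := by exact_mod_cast (by omega : 0 < n)
  have hmd : (m : ℝ) + 1 ≤ d := by exact_mod_cast hd
  have hdn' : (d : ℝ) ≤ n := by exact_mod_cast hdn
  have h1 : levelDown m AccOp.OI d = d - 1 := by simp [levelDown, hd]
  have h2 : levelUp m AccOp.OI d = d := by simp [levelUp]; omega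
  rw [levelMean, h1, h2, opMean, opMean, returnPotential_OI (by omega) (by omega),
    returnPotential_OI (by omega) (by omega), returnPotential_AM hd]
  have h3 := returnPotential_AM_le (a := a) (α := α) hp hβ (by omega : 0 < d - 1)
    (by omega : m ≤ d - 1)
  rw [Nat.cast_sub (by omega)] at h3 ⊢
  push_cast at h3 ⊢
  have hc1 : 0 ≤ (d : ℝ) / n := by positivity
  have h4 := mul_le_mul_of_nonneg_left (mul_le_mul_of_nonneg_left h3 hp.le) hc1
  have h5 : (d : ℝ) / n ≤ 1 := (div_le_one hn).2 hdn'
  -- Switching to `AM` replaces slope a by α ≤ a, at distance d - m - d/n from m on average, which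
  -- is nonnegative. So a switch costs at most β.
  have h6 : 0 ≤ p * (a - α) * ((d : ℝ) - m - d / n) :=
    mul_nonneg (mul_nonneg hp.le (by linarith)) (by linarith)
  have h7 : a * (m + 1) / n ≤ a * (d / n) := by
    rw [mul_div_assoc]; gcongr
  have h8 : ((n : ℝ) - d) / n = 1 - d / n := by field_simp
  rw [h8]
  generalize (d : ℝ) / n = x at *
  linear_combination h4 + h6 + h7 + hOI

/-- Above the local optimum, operator `AM` loses little before the switch to `OI`. -/
lemma levelMean_returnPotential_AM_of_gt (hm : 0 < m) (hp : 0 < p) (hq : q < 1) (hβ : 0 ≤ β)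
    (hα : α = (1 - 2 / n) * ((1 - q) * α + q * a))
    (hAM : q * β = 1 + (n - 2 * m) / n * ((1 - q) * α + q * a)) {d : ℕ} (hd : m < d)
    (hdn : d ≤ n) :
    1 + levelMean n m p q (returnPotential m p a α β) d AccOp.AM ≤
      returnPotential m p a α β d AccOp.AM := by
  have hn : (0 : ℝ) < n := by exact_mod_cast (by omega : 0 < n)
  rw [levelMean, levelDown, levelUp, opMean, opMean, returnPotential_OI (by omega) (by omega),
    returnPotential_OI (by omega) (by omega), returnPotential_AM hd,
    returnPotential_AM (by omega : m < d + 1)]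
  have h3 := returnPotential_AM_le (a := a) (α := α) hp hβ (by omega : 0 < d - 1)
    (by omega : m ≤ d - 1)
  rw [Nat.cast_sub (by omega)] at h3 ⊢
  push_cast at h3 ⊢
  have hc1 : 0 ≤ (d : ℝ) / n := by positivity
  have h4 := mul_le_mul_of_nonneg_left (mul_le_mul_of_nonneg_left h3 (sub_nonneg.2 hq.le)) hc1
  have h8 : ((n : ℝ) - d) / n = 1 - d / n := by field_simp
  have h9 : ((n : ℝ) - 2 * m) / n = 1 - m * (2 / n) := by field_simp
  have h10 : (d : ℝ) / n = d * (2 / n) / 2 := by field_simp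
  rw [h9] at hAM
  rw [h8]
  rw [h10] at h4 ⊢
  generalize (2 : ℝ) / n = y at *
  -- The mean of d' - m is (1 - 2/n)(d - m) + (n - 2m)/n, and the mean slope after the operator
  -- update is (1-q)α + qa. Matching slope and constant term gives exactly `hα` and `hAM`; the only
  -- slack is `h4`.
  linear_combination h4 - (d - m : ℝ) * hα - hAM

end returnPotential

/-! ### The descent probability -/

section descentProb

variable {n m : ℕ} {q : ℝ}

lemma descentProb_nonneg (hq1 : q < 1) (d : ℕ) (s : AccOp) : 0 ≤ descentProb n m q d s := by
  have : 0 < 1 - q := by linarith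
  cases s <;> simp only [descentProb] <;> split_ifs <;> positivity

lemma descentProb_le_one (hmn : m ≤ n) (hq : 0 < q) (hq1 : q < 1) (d : ℕ) (s : AccOp) :
    descentProb n m q d s ≤ 1 := by
  cases s
  · simp only [descentProb]
    split_ifs
    · rfl
    · rw [one_div]; exact Nat.cast_inv_le_one n
    · exact zero_le_one
  · simp only [descentProb]
    split_ifs with h
    · have h1 : (d ! : ℝ) / (n : ℝ) ^ d ≤ 1 := by
        apply div_le_one_of_le₀ _ (by positivity)
        exact_mod_cast (Nat.factorial_le_pow d).trans (Nat.pow_le_pow_left (by omega) d)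
      have h2 : 0 ≤ 1 - q := by linarith
      exact mul_le_one₀ h1 (pow_nonneg h2 _) (pow_le_one₀ h2 (by linarith))
    · exact zero_le_one

lemma opMean_descentProb_nonneg {p : ℝ} (hp : 0 < p) (hp1 : p < 1) (hq : 0 < q) (hq1 : q < 1)
    (d : ℕ) (s : AccOp) : 0 ≤ opMean p q (descentProb n m q d) s := by
  have h1 : 0 < 1 - q := by linarith
  have h2 : 0 < 1 - p := by linarith
  have h3 := descentProb_nonneg (n := n) (m := m) hq1 d AccOp.OI
  have h4 := descentProb_nonneg (n := n) (m := m) hq1 d AccOp.AM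
  cases s <;> simp only [opMean] <;> positivity

lemma opMean_descentProb_zero {p : ℝ} (hm : 0 < m) (s : AccOp) :
    opMean p q (descentProb n m q 0) s = 1 := by
  cases s <;> simp [opMean, descentProb, hm]

/-- Flip one of the remaining zeros in every step. `AM` has to persist only on reaching levels d-1,
..., 2, since at level 1 both operators accept the optimum: hence the exponent d - 2, truncated to 0
for d ≤ 2. The case d = m is included, although `descentProb` is 0 there; this jump is the gain ρ.
-/
lemma le_levelMean_descentProb_AM {p : ℝ} (hm : 1 < m) (hmn : m ≤ n) (hp : 0 < p) (hp1 : p < 1)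
    (hq : 0 < q) (hq1 : q < 1) {d : ℕ} (h0 : 0 < d) (hd : d ≤ m) :
    (d ! : ℝ) / (n : ℝ) ^ d * (1 - q) ^ (d - 2) ≤
      levelMean n m p q (descentProb n m q) d AccOp.AM := by
  have hn : (0 : ℝ) < n := by exact_mod_cast (by omega : 0 < n)
  have hdn : (d : ℝ) ≤ n := by exact_mod_cast hd.trans hmn
  rw [levelMean, levelDown, levelUp]
  have h1 : 0 ≤ ((n : ℝ) - d) / n * opMean p q (descentProb n m q (d + 1)) AccOp.AM :=
    mul_nonneg (div_nonneg (by linarith) hn.le) (opMean_descentProb_nonneg hp hp1 hq hq1 _ _)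
  refine le_trans ?_ (le_add_of_nonneg_right h1)
  obtain ⟨e, rfl⟩ : ∃ e, d = e + 1 := ⟨d - 1, by omega⟩
  have h2 : ((e + 1)! : ℝ) / (n : ℝ) ^ (e + 1) =
      ((e + 1 : ℕ) : ℝ) / n * ((e ! : ℝ) / (n : ℝ) ^ e) := by
    rw [Nat.factorial_succ, pow_succ]; push_cast; field_simp
  rw [h2, mul_assoc, Nat.add_sub_cancel]
  refine mul_le_mul_of_nonneg_left ?_ (by positivity)
  match e with
  | 0 => simp [opMean_descentProb_zero (by omega : 0 < m)]
  | 1 =>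
    apply le_of_eq
    simp [opMean, descentProb, hm]
    ring
  | e + 2 =>
    have h3 : descentProb n m q (e + 2) AccOp.AM =
        ((e + 2)! : ℝ) / (n : ℝ) ^ (e + 2) * (1 - q) ^ e := by
      simp only [descentProb]; rw [if_pos (by omega)]; simp
    have h4 : descentProb n m q (e + 2) AccOp.OI = 0 := by simp [descentProb]
    rw [opMean, h3, h4]
    apply le_of_eq
    rw [show e + 2 + 1 - 2 = e + 1 by omega, pow_succ]
    ring

lemma descentProb_le_levelMean {p : ℝ} (hm : 1 < m) (hmn : m ≤ n) (hp : 0 < p) (hp1 : p < 1)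
    (hq : 0 < q) (hq1 : q < 1) {d : ℕ} (h0 : 0 < d) (hd : d ≤ n) (s : AccOp) :
    descentProb n m q d s ≤ levelMean n m p q (descentProb n m q) d s := by
  have hn : (0 : ℝ) < n := by exact_mod_cast (by omega : 0 < n)
  have hdn : (0 : ℝ) ≤ n - d := by rw [sub_nonneg]; exact_mod_cast hd
  have hup : 0 ≤ ((n : ℝ) - d) / n * opMean p q (descentProb n m q (levelUp m s d)) s :=
    mul_nonneg (div_nonneg hdn hn.le) (opMean_descentProb_nonneg hp hp1 hq hq1 _ _)
  have hdown : 0 ≤ (d : ℝ) / n * opMean p q (descentProb n m q (levelDown m s d)) s :=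
    mul_nonneg (by positivity) (opMean_descentProb_nonneg hp hp1 hq hq1 _ _)
  have hnn : 0 ≤ levelMean n m p q (descentProb n m q) d s := add_nonneg hdown hup
  cases s with
  | AM =>
    by_cases h : d < m
    · refine le_trans ?_ (le_levelMean_descentProb_AM hm hmn hp hp1 hq hq1 h0 h.le)
      simp [descentProb, h]
    · simpa [descentProb, h] using hnn
  | OI =>
    by_cases h : d = 1
    · subst h
      refine le_trans ?_ (le_add_of_nonneg_right hup)
      have : levelDown m AccOp.OI 1 = 0 := by simp [levelDown]
      rw [this, opMean_descentProb_zero (by omega)]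
      simp [descentProb]
    · simpa [descentProb, h, h0.ne'] using hnn

end descentProb

/-! ### The combined potential and the general bound -/

/-- Any solution of the linear drift conditions yields a runtime bound. -/
theorem expectedRuntime_le_of_linear {n m : ℕ} [NeZero n] {p q : unitInterval} {a α β : ℝ}
    (hm : 1 < m) (hmn : 2 * m < n) (hp : (0 : ℝ) < p) (hp1 : (p : ℝ) < 1) (hq : (0 : ℝ) < q)
    (hq1 : (q : ℝ) < 1) (ha : 0 ≤ a) (hα0 : 0 ≤ α) (hαa : α ≤ a) (hβ : 0 ≤ β)
    (hOI : 1 + p * β ≤ a * (m + 1) / n)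
    (hα : α = (1 - 2 / n) * ((1 - q) * α + q * a))
    (hAM : q * β = 1 + (n - 2 * m) / n * ((1 - q) * α + q * a)) :
    expectedRuntime n m p q ≤ ENNReal.ofReal
      ((n : ℝ) ^ 2 + a * n + β + 1 / p +
        (m + a + β + 1 / p + 1) / ((m ! : ℝ) / (n : ℝ) ^ m * (1 - q) ^ (m - 2))) := by
  have hn : (0 : ℝ) < n := by exact_mod_cast (by omega : 0 < n)
  have hq' : 0 < 1 - (q : ℝ) := by linarith
  set ρ : ℝ := (m ! : ℝ) / (n : ℝ) ^ m * (1 - q) ^ (m - 2) with hρ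
  have hρ0 : 0 < ρ := by positivity
  set K : ℝ := (m + a + β + 1 / p + 1) / ρ with hK
  have hK0 : 0 ≤ K := by positivity
  have hKρ : K * ρ = m + a + β + 1 / p + 1 := by rw [hK]; field_simp
  have hmean : ∀ d s, levelMean n m p q (fun d s => returnPotential m p a α β d s +
      K * (1 - descentProb n m q d s)) d s =
      levelMean n m p q (returnPotential m p a α β) d s +
        K * (1 - levelMean n m p q (descentProb n m q) d s) := by
    intro d s
    have h : ((n : ℝ) - d) / n = 1 - d / n := by field_simp
    cases s <;> simp only [levelMean, opMean, h] <;> ring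
  refine expectedRuntime_le hm hmn p q (Φ := fun d s => returnPotential m p a α β d s +
    K * (1 - descentProb n m q d s)) ?_ ?_ ?_
  · intro d s
    exact add_nonneg (returnPotential_nonneg hp ha hα0 hβ d s) (mul_nonneg hK0
      (sub_nonneg.2 (descentProb_le_one (by omega) hq hq1 d s)))
  · intro d s h0 hd
    rw [hmean]
    by_cases hs : d = m ∧ s = AccOp.AM
    · obtain ⟨rfl, rfl⟩ := hs
      have h1 := levelMean_returnPotential_self_AM hm hmn hp hp1 hq hq1 ha hαa hβ
      have h2 := le_levelMean_descentProb_AM hm (by omega) hp hp1 hq hq1 h0 (le_refl d)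
        (n := n)
      have h3 : descentProb n d q d AccOp.AM = 0 := by simp [descentProb]
      rw [returnPotential_AM_self, h3]
      have := mul_le_mul_of_nonneg_left h2 hK0
      rw [← hρ] at this
      linarith
    · have h1 : 1 + levelMean n m p q (returnPotential m p a α β) d s ≤
          returnPotential m p a α β d s := by
        rcases lt_trichotomy d m with h | rfl | h
        · exact levelMean_returnPotential_of_lt hmn hp hp1 hq hq1 h0 h s
        · cases s
          · exact levelMean_returnPotential_self_OI hm hmn hp
          · simp at hs
        · cases s
          · exact levelMean_returnPotential_OI_of_gt hp ha hαa hβ hOI h hd (by omega)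
          · exact levelMean_returnPotential_AM_of_gt (by omega) hp hq1 hβ hα hAM h hd
      have h2 := mul_le_mul_of_nonneg_left
        (descentProb_le_levelMean hm (by omega) hp hp1 hq hq1 h0 hd s (n := n)) hK0
      linarith
  · intro d s hd
    have h1 := mul_nonneg hK0 (descentProb_nonneg (n := n) (m := m) hq1 d s)
    have hp' : 0 < 1 / (p : ℝ) := by positivity
    have hdn : (d : ℝ) ≤ n := by exact_mod_cast hd
    have hm0 : (0 : ℝ) ≤ m := by positivity
    have han : 0 ≤ a * n := by positivity
    have hadm : ∀ c, c ≤ a → 0 ≤ c → c * ((d : ℝ) - m) ≤ a * n := fun c hc hc0 =>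
      (mul_le_mul_of_nonneg_left (by linarith : (d : ℝ) - m ≤ n) hc0).trans
        (mul_le_mul_of_nonneg_right hc hn.le)
    have h2 : returnPotential m p a α β d s ≤ (n : ℝ) ^ 2 + a * n + β + 1 / p := by
      rcases Nat.eq_zero_or_pos d with rfl | h0
      · rw [returnPotential_zero]; positivity
      rcases lt_or_ge d m with h | h
      · rw [returnPotential_of_lt h0 h]
        have hmn' : (m : ℝ) + 1 ≤ n := by exact_mod_cast (by omega : m + 1 ≤ n)
        have hd0 : (0 : ℝ) ≤ d := by positivity
        nlinarith
      · cases s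
        · rw [returnPotential_OI h0 h]
          linarith [hadm a le_rfl ha, sq_nonneg (n : ℝ)]
        · refine (returnPotential_AM_le hp hβ h0 h).trans ?_
          linarith [hadm α hαa hα0, sq_nonneg (n : ℝ)]
    linarith

/-- The general runtime bound. -/
theorem expectedRuntime_le_general {n m : ℕ} [NeZero n] {p q : unitInterval}
    (hm : 1 < m) (hmn : 2 * m < n) (hp : (0 : ℝ) < p) (hp1 : (p : ℝ) < 1) (hq : (0 : ℝ) < q)
    (hq1 : (q : ℝ) < 1)
    (hpq : (m : ℝ) / (2 * ((n : ℝ) - 2 * m)) * ((q : ℝ) + 4 / n) ≥ p) :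
    expectedRuntime n m p q ≤ ENNReal.ofReal
      (4 * ((1 + (p : ℝ) * n) * (1 / (p : ℝ) + 1 / (q : ℝ)) *
        ((n : ℝ) + (n : ℝ) ^ m / (((m - 1)! : ℕ) * (1 - (q : ℝ)) ^ (m - 2))))) := by
  have hm2 : (2 : ℝ) ≤ m := by exact_mod_cast hm
  have hmn' : 2 * (m : ℝ) + 1 ≤ n := by exact_mod_cast hmn
  have hn : (0 : ℝ) < n := by linarith
  have hq' : 0 < 1 - (q : ℝ) := by linarith
  have hm0 : (0 : ℝ) < m := by linarith
  generalize hP : (p : ℝ) = P at *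
  generalize hQ : (q : ℝ) = Q at *
  have h2n : 2 / (n : ℝ) ≤ 1 / 2 := by rw [div_le_div_iff₀ hn two_pos]; linarith
  have h2n0 : 0 < 2 / (n : ℝ) := by positivity
  -- D = 1 - (1 - 2/n)(1 - Q) is the coefficient of α when the slope equation is solved for α; then
  -- α and β below solve `hα` and `hAM` exactly for any a.
  set D : ℝ := Q + 2 / n - 2 / n * Q with hD
  have hDQ : Q / 2 + 2 / n ≤ D := by
    rw [hD]; nlinarith
  have hD0 : 0 < D := by linarith
  have hDle : Q * (1 - 2 / n) ≤ D := by rw [hD]; linarith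
  -- Chosen so that a/n = 1 + P/Q pays for the 1 and the 1/Q part of β in `hOI`; the rest of β must
  -- be covered by a·m/n.
  set a : ℝ := n * (1 + P / Q) with ha
  have ha0 : 0 < a := by positivity
  set α : ℝ := a * (Q * (1 - 2 / n) / D) with hα
  have hα0 : 0 ≤ α := mul_nonneg ha0.le (div_nonneg (mul_nonneg hq.le (by linarith)) hD0.le)
  have hαa : α ≤ a := mul_le_of_le_one_right ha0.le ((div_le_one hD0).2 hDle)
  set δ : ℝ := (n - 2 * m) / n with hδ
  have hδ0 : 0 ≤ δ := div_nonneg (by linarith) hn.le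
  set β : ℝ := 1 / Q + δ * (a / D) with hβ
  have hβ0 : 0 ≤ β := by positivity
  have hmix : (1 - Q) * α + Q * a = a * Q / D := by
    have h : α * D = a * (Q * (1 - 2 / n)) := by rw [hα]; field_simp
    rw [eq_div_iff hD0.ne']
    linear_combination (1 - Q) * h + Q * a * hD
  -- The only use of the hypothesis relating p and q, whose right form is P(n - 2m) ≤ m(Q/2 + 2/n) ≤
  -- mD.
  have hPδ : P * δ ≤ D * (m / n) := by
    have h1 : P * (n - 2 * m) ≤ m * (Q / 2 + 2 / n) := by
      have h3 : (0 : ℝ) < n - 2 * m := by linarith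
      calc P * (n - 2 * m) ≤ (m : ℝ) / (2 * ((n : ℝ) - 2 * m)) * (Q + 4 / n) * (n - 2 * m) :=
            mul_le_mul_of_nonneg_right hpq h3.le
        _ = m * (Q / 2 + 2 / n) := by
            generalize (n : ℝ) - 2 * m = t at h3
            field_simp
            ring
    have h2 : m * (Q / 2 + 2 / n) ≤ m * D := mul_le_mul_of_nonneg_left hDQ hm0.le
    rw [hδ, ← mul_div_assoc, ← mul_div_assoc]
    apply div_le_div_of_nonneg_right _ hn.le
    linarith
  have hPβ : P * (δ * (a / D)) ≤ a * m / n := by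
    calc P * (δ * (a / D)) = P * δ * (a / D) := by ring
      _ ≤ D * (m / n) * (a / D) := mul_le_mul_of_nonneg_right hPδ (by positivity)
      _ = a * m / n := by field_simp
  have han : a / n = 1 + P / Q := by rw [ha]; field_simp
  have hmain := expectedRuntime_le_of_linear (n := n) (p := p) (q := q) hm hmn
    (by rw [hP]; exact hp) (by rw [hP]; exact hp1) (by rw [hQ]; exact hq)
    (by rw [hQ]; exact hq1) ha0.le hα0 hαa hβ0
    (by
      rw [hP, hβ]
      have : a * (m + 1) / n = a * m / n + a / n := by ring
      rw [this, han]
      have : P * (1 / Q + δ * (a / D)) = P / Q + P * (δ * (a / D)) := by ring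
      linarith)
    (by rw [hQ, hmix, hα]; ring)
    (by
      rw [hQ, hmix, hβ, ← hδ]
      field_simp)
  refine hmain.trans (ENNReal.ofReal_le_ofReal ?_)
  rw [hP, hQ]
  set S : ℝ := (1 + P * n) * (1 / P + 1 / Q) with hS
  have hSeq : S = 1 / P + 1 / Q + a := by rw [hS, ha]; field_simp
  have hP' : 0 < 1 / P := by positivity
  have hQ' : 0 < 1 / Q := by positivity
  have hna : n ≤ a := by
    rw [ha]
    exact le_mul_of_one_le_right hn.le (le_add_of_nonneg_right (by positivity))
  have hS0 : 0 < S := by linarith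
  have hβS : β ≤ (m + 1) * S := by
    have h1 : δ * (a / D) ≤ m * (1 / P + 1 / Q) := by
      have h2 : m * (1 / P + 1 / Q) = a * m / n / P := by
        rw [mul_div_right_comm, han]; field_simp
      rw [h2, le_div_iff₀ hp]
      linarith
    have h3 : m * (1 / P + 1 / Q) ≤ m * S := mul_le_mul_of_nonneg_left (by linarith) hm0.le
    rw [hβ]
    linarith
  have hfirst : (n : ℝ) ^ 2 + a * n + β + 1 / P ≤ 4 * (S * n) := by
    have h1 : (n : ℝ) * n ≤ S * n := mul_le_mul_of_nonneg_right (by linarith) hn.le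
    have h2 : a * n ≤ S * n := mul_le_mul_of_nonneg_right (by linarith) hn.le
    have h3 : (m + 2) * S ≤ 2 * n * S := mul_le_mul_of_nonneg_right (by linarith) hS0.le
    linarith
  have hsecond : m + a + β + 1 / P + 1 ≤ 4 * (m * S) := by
    have h1 : 2 * S ≤ m * S := mul_le_mul_of_nonneg_right hm2 hS0.le
    linarith
  -- The factor m lost in bounding the return cost by 4mS turns 1/m! into 1/(m-1)!.
  have hfac : (m ! : ℝ) = m * ((m - 1)! : ℕ) := by
    exact_mod_cast (Nat.mul_factorial_pred (by omega)).symm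
  have hlast : (m + a + β + 1 / P + 1) / ((m ! : ℝ) / (n : ℝ) ^ m * (1 - Q) ^ (m - 2)) ≤
      4 * (S * ((n : ℝ) ^ m / (((m - 1)! : ℕ) * (1 - Q) ^ (m - 2)))) := by
    calc _ ≤ 4 * (m * S) / ((m ! : ℝ) / (n : ℝ) ^ m * (1 - Q) ^ (m - 2)) := by gcongr
      _ = _ := by
        rw [hfac]
        have : (0 : ℝ) < ((m - 1)! : ℕ) := by exact_mod_cast Nat.factorial_pos _
        have h4 : 0 < (1 - Q) ^ (m - 2) := by positivity
        field_simp
  linarith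

/-! ### Special parameter choices -/

lemma condition_of_le {n m : ℕ} {p q : ℝ} (hmn : 2 * m < n) (hq : 0 < q)
    (h : (m : ℝ) / (2 * n) * q ≥ p) :
    (m : ℝ) / (2 * ((n : ℝ) - 2 * m)) * (q + 4 / n) ≥ p := by
  have hmn' : 2 * (m : ℝ) + 1 ≤ n := by exact_mod_cast hmn
  have hm0 : (0 : ℝ) ≤ m := by positivity
  have hn : (0 : ℝ) < n := by linarith
  refine h.le.trans ?_
  have h4 : 0 ≤ 4 / (n : ℝ) := by positivity
  have h5 : (0 : ℝ) < n - 2 * m := by linarith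
  gcongr
  · linarith
  · linarith

/-- The runtime bound for `p = m q / (c n)`. -/
lemma expectedRuntime_le_of_eq {n m : ℕ} [NeZero n] {p q : unitInterval} {c : ℝ} (hc : 2 ≤ c)
    (hm : 1 < m) (hmn : 2 * m < n) (hq : (0 : ℝ) < q) (hq1 : (q : ℝ) < 1)
    (hp : (p : ℝ) = (m : ℝ) / (c * n) * q) :
    expectedRuntime n m p q ≤ ENNReal.ofReal
      (4 * ((1 + m * q / c) * (c / (m * q) + 1 / (n * q)) * ((n : ℝ) ^ 2 +
        (n : ℝ) ^ (m + 1) / (((m - 1)! : ℕ) * (1 - (q : ℝ)) ^ (m - 2))))) := by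
  have hm2 : (2 : ℝ) ≤ m := by exact_mod_cast hm
  have hmn' : 2 * (m : ℝ) + 1 ≤ n := by exact_mod_cast hmn
  have hm0 : (0 : ℝ) < m := by linarith
  have hn : (0 : ℝ) < n := by linarith
  have hc0 : 0 < c := by linarith
  have hple : (p : ℝ) ≤ m / (2 * n) * q := by
    rw [hp]; gcongr
  have hp0 : (0 : ℝ) < p := by rw [hp]; positivity
  have hp1 : (p : ℝ) < 1 := by
    have h1 : (m : ℝ) / (2 * n) ≤ 1 := by rw [div_le_one (by positivity)]; linarith
    calc (p : ℝ) ≤ m / (2 * n) * q := hple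
      _ ≤ 1 * q := by gcongr
      _ < 1 := by linarith
  refine (expectedRuntime_le_general hm hmn hp0 hp1 hq hq1 (condition_of_le hmn hq hple)).trans
    (le_of_eq ?_)
  congr 1
  rw [hp]
  have hq' : 0 < (1 - (q : ℝ)) ^ (m - 2) := by
    have : 0 < 1 - (q : ℝ) := by linarith
    positivity
  have : (0 : ℝ) < ((m - 1)! : ℕ) := by exact_mod_cast Nat.factorial_pos _
  field_simp
  ring

lemma two_pow_le_factorial {m : ℕ} (hm : 1 < m) : 2 ^ (m - 2) ≤ (m - 1)! := by
  obtain ⟨k, rfl⟩ : ∃ k, m = k + 2 := ⟨m - 2, by omega⟩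
  have := Nat.factorial_mul_pow_le_factorial (m := 1) (n := k)
  simpa [add_comm] using this

lemma factorial_pred_le_pow {n m : ℕ} (hm : 1 < m) (hmn : m ≤ n) : (m - 1)! ≤ n ^ (m - 1) :=
  (Nat.factorial_le_pow _).trans (Nat.pow_le_pow_left (by omega) _)

/-- The base is 1 + 1/(dm-1) ≤ exp(1/(dm-1)), and (m-2)/(dm-1) ≤ 1/d because 2d ≥ 1. -/
lemma inv_one_sub_pow_le_exp {m : ℕ} (hm : 1 < m) {d : ℝ} (hd : 1 ≤ d) :
    1 / (1 - 1 / (d * m)) ^ (m - 2) ≤ Real.exp (1 / d) := by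
  have hm2 : (2 : ℝ) ≤ m := by exact_mod_cast hm
  have hdm : 2 ≤ d * m := by nlinarith
  have hdm1 : 0 < d * m - 1 := by linarith
  have h1 : 1 / (1 - 1 / (d * m)) = 1 / (d * m - 1) + 1 := by
    have : 1 - 1 / (d * m) = (d * m - 1) / (d * m) := by field_simp
    rw [this]; field_simp; ring
  rw [← one_div_pow, h1]
  calc (1 / (d * m - 1) + 1) ^ (m - 2) ≤ Real.exp (1 / (d * m - 1)) ^ (m - 2) := by
        gcongr
        exact Real.add_one_le_exp _
    _ = Real.exp ((m - 2 : ℕ) * (1 / (d * m - 1))) := by rw [← Real.exp_nat_mul]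
    _ ≤ Real.exp (1 / d) := by
        rw [Real.exp_le_exp, Nat.cast_sub (by omega), mul_one_div,
          div_le_div_iff₀ hdm1 (by linarith)]
        push_cast
        linarith

end MMAHH

theorem mainTheorem2 :
    (∃ C : ℝ, 0 < C ∧ ∀ (n m : ℕ) [NeZero n] (p q : unitInterval),
      1 < m → 2 * m < n → 0 < p → p < 1 → 0 < q → q < 1 →
      (m : ℝ) / (2 * ((n : ℝ) - 2 * m)) * ((q : ℝ) + 4 / n) ≥ p →
      MMAHH.expectedRuntime n m p q ≤ ENNReal.ofReal
        (C * ((1 + (p : ℝ) * n) * (1 / (p : ℝ) + 1 / (q : ℝ)) *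
          ((n : ℝ) + (n : ℝ) ^ m / (((m - 1)! : ℕ) * (1 - (q : ℝ)) ^ (m - 2)))))) ∧
    (∀ (n m : ℕ) (p q : unitInterval),
      1 < m → 2 * m < n → 0 < p → p < 1 → 0 < q → q < 1 →
      (m : ℝ) / (2 * n) * (q : ℝ) ≥ p →
      (m : ℝ) / (2 * ((n : ℝ) - 2 * m)) * ((q : ℝ) + 4 / n) ≥ p) ∧
    (∀ c : ℝ, 2 ≤ c → ∃ C : ℝ, 0 < C ∧ ∀ (n m : ℕ) [NeZero n] (p q : unitInterval),
      1 < m → 2 * m < n → (q : ℝ) = 1 / 2 → (p : ℝ) = (m : ℝ) / (c * n) * q →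
      MMAHH.expectedRuntime n m p q ≤ ENNReal.ofReal
        (C * ((n : ℝ) ^ 2 + 2 ^ (m - 2) * (n : ℝ) ^ (m + 1) / ((m - 1)! : ℕ))) ∧
      (n : ℝ) ^ 2 + 2 ^ (m - 2) * (n : ℝ) ^ (m + 1) / ((m - 1)! : ℕ) ≤ C * (n : ℝ) ^ (m + 1) ∧
      MMAHH.expectedRuntime n m p q ≤ ENNReal.ofReal (C * (n : ℝ) ^ (m + 1))) ∧
    (∀ c d : ℝ, 2 ≤ c → 1 ≤ d → ∃ C : ℝ, 0 < C ∧ ∀ (n m : ℕ) [NeZero n] (p q : unitInterval),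
      1 < m → 2 * m < n → (q : ℝ) = 1 / (d * m) → (p : ℝ) = (m : ℝ) / (c * n) * q →
      MMAHH.expectedRuntime n m p q ≤ ENNReal.ofReal
        (C * ((n : ℝ) ^ 2 + Real.exp (1 / d) * (n : ℝ) ^ (m + 1) / ((m - 1)! : ℕ))) ∧
      (n : ℝ) ^ 2 + Real.exp (1 / d) * (n : ℝ) ^ (m + 1) / ((m - 1)! : ℕ) ≤
        C * ((n : ℝ) ^ (m + 1) / ((m - 1)! : ℕ)) ∧
      MMAHH.expectedRuntime n m p q ≤
        ENNReal.ofReal (C * ((n : ℝ) ^ (m + 1) / ((m - 1)! : ℕ)))) := by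
  refine ⟨⟨4, by norm_num, fun n m _ p q hm hmn hp hp1 hq hq1 h =>
    MMAHH.expectedRuntime_le_general hm hmn hp hp1 hq hq1 h⟩,
    fun n m p q _ hmn _ _ hq _ h => MMAHH.condition_of_le hmn hq h, ?_, ?_⟩
  · intro c hc
    have hc0 : 0 < c := by linarith
    -- The general bound gives 4·2(c+1); the further factor 2 comes from `hsum`, where 2^(m-2) ≤
    -- (m-1)!.
    refine ⟨16 * (c + 1), by positivity, fun n m _ p q hm hmn hq hp => ?_⟩
    have hm2 : (2 : ℝ) ≤ m := by exact_mod_cast hm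
    have hmn' : 2 * (m : ℝ) + 1 ≤ n := by exact_mod_cast hmn
    have hn : (0 : ℝ) < n := by linarith
    have hfac0 : (0 : ℝ) < ((m - 1)! : ℕ) := by exact_mod_cast Nat.factorial_pos _
    have hsum : (n : ℝ) ^ 2 + 2 ^ (m - 2) * (n : ℝ) ^ (m + 1) / ((m - 1)! : ℕ) ≤
        2 * (n : ℝ) ^ (m + 1) := by
      have h1 : (n : ℝ) ^ 2 ≤ (n : ℝ) ^ (m + 1) := pow_le_pow_right₀ (by linarith) (by omega)
      have h2 : (2 : ℝ) ^ (m - 2) ≤ ((m - 1)! : ℕ) := by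
        exact_mod_cast MMAHH.two_pow_le_factorial hm
      have h3 : 2 ^ (m - 2) * (n : ℝ) ^ (m + 1) / ((m - 1)! : ℕ) ≤ (n : ℝ) ^ (m + 1) := by
        rw [div_le_iff₀ hfac0, mul_comm]; gcongr
      linarith
    have hrun : MMAHH.expectedRuntime n m p q ≤ ENNReal.ofReal
        (8 * (c + 1) * ((n : ℝ) ^ 2 + 2 ^ (m - 2) * (n : ℝ) ^ (m + 1) / ((m - 1)! : ℕ))) := by
      refine (MMAHH.expectedRuntime_le_of_eq hc hm hmn (by rw [hq]; norm_num)
        (by rw [hq]; norm_num) hp).trans (ENNReal.ofReal_le_ofReal ?_)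
      rw [hq]
      have h1 : (n : ℝ) ^ (m + 1) / (((m - 1)! : ℕ) * (1 - 1 / 2) ^ (m - 2)) =
          2 ^ (m - 2) * (n : ℝ) ^ (m + 1) / ((m - 1)! : ℕ) := by
        rw [show (1 - 1 / 2 : ℝ) = 2⁻¹ by norm_num, inv_pow]
        field_simp
      rw [h1, ← mul_assoc]
      refine mul_le_mul_of_nonneg_right ?_ (by positivity)
      have h2 : 1 + m * (1 / 2) / c ≤ m := by
        have : m * (1 / 2) / c ≤ (m : ℝ) / 4 := by
          rw [div_le_div_iff₀ hc0 (by norm_num)]; nlinarith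
        linarith
      have h3 : 0 ≤ c / (m * (1 / 2)) + 1 / ((n : ℝ) * (1 / 2)) := by positivity
      have h4 : (m : ℝ) * (c / (m * (1 / 2)) + 1 / ((n : ℝ) * (1 / 2))) ≤ 2 * (c + 1) := by
        have : (m : ℝ) * (c / (m * (1 / 2)) + 1 / ((n : ℝ) * (1 / 2))) = 2 * c + 2 * (m / n) := by
          field_simp
        have h5 : (m : ℝ) / n ≤ 1 := by rw [div_le_one hn]; linarith
        linarith
      linarith [mul_le_mul_of_nonneg_right h2 h3]
    refine ⟨hrun.trans (ENNReal.ofReal_le_ofReal ?_), hsum.trans ?_,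
      hrun.trans (ENNReal.ofReal_le_ofReal ?_)⟩
    · gcongr; norm_num
    · gcongr; linarith
    · calc _ ≤ 8 * (c + 1) * (2 * (n : ℝ) ^ (m + 1)) := by gcongr
        _ = _ := by ring
  · intro c d hc hd
    have hc0 : 0 < c := by linarith
    have hd0 : 0 < d := by linarith
    have he0 := Real.exp_pos (1 / d)
    -- Since mq = 1/d, the two prefactors are at most 2 and 2cd, giving 4·2·2cd. The factor 1 +
    -- exp(1/d) comes from `hsum`, using (m-1)! ≤ n^(m-1) to absorb n².
    refine ⟨16 * (c * d) * (1 + Real.exp (1 / d)), by positivity,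
      fun n m _ p q hm hmn hq hp => ?_⟩
    have hm2 : (2 : ℝ) ≤ m := by exact_mod_cast hm
    have hmn' : 2 * (m : ℝ) + 1 ≤ n := by exact_mod_cast hmn
    have hn : (0 : ℝ) < n := by linarith
    have hm0 : (0 : ℝ) < m := by linarith
    have hcd : 1 ≤ c * d := by nlinarith
    have hfac0 : (0 : ℝ) < ((m - 1)! : ℕ) := by exact_mod_cast Nat.factorial_pos _
    have hsum : (n : ℝ) ^ 2 + Real.exp (1 / d) * (n : ℝ) ^ (m + 1) / ((m - 1)! : ℕ) ≤
        (1 + Real.exp (1 / d)) * ((n : ℝ) ^ (m + 1) / ((m - 1)! : ℕ)) := by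
      have h1 : (n : ℝ) ^ 2 ≤ (n : ℝ) ^ (m + 1) / ((m - 1)! : ℕ) := by
        rw [le_div_iff₀ hfac0, show m + 1 = 2 + (m - 1) by omega, pow_add]
        gcongr
        exact_mod_cast MMAHH.factorial_pred_le_pow hm (by omega)
      rw [mul_div_assoc]
      linarith
    have hdm : 2 ≤ d * m := by nlinarith
    have hq0 : (0 : ℝ) < q := by rw [hq]; positivity
    have hq1 : (q : ℝ) < 1 := by rw [hq, div_lt_one (by positivity)]; linarith
    have hrun : MMAHH.expectedRuntime n m p q ≤ ENNReal.ofReal (16 * (c * d) *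
        ((n : ℝ) ^ 2 + Real.exp (1 / d) * (n : ℝ) ^ (m + 1) / ((m - 1)! : ℕ))) := by
      refine (MMAHH.expectedRuntime_le_of_eq hc hm hmn hq0 hq1 hp).trans
        (ENNReal.ofReal_le_ofReal ?_)
      have hq' : 0 < (1 - (q : ℝ)) ^ (m - 2) := by
        have : 0 < 1 - (q : ℝ) := by linarith
        positivity
      have h1 : (n : ℝ) ^ (m + 1) / (((m - 1)! : ℕ) * (1 - (q : ℝ)) ^ (m - 2)) ≤
          Real.exp (1 / d) * (n : ℝ) ^ (m + 1) / ((m - 1)! : ℕ) := by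
        calc _ = 1 / (1 - (q : ℝ)) ^ (m - 2) * ((n : ℝ) ^ (m + 1) / ((m - 1)! : ℕ)) := by
              field_simp
          _ ≤ Real.exp (1 / d) * ((n : ℝ) ^ (m + 1) / ((m - 1)! : ℕ)) := by
              gcongr
              rw [hq]
              exact MMAHH.inv_one_sub_pow_le_exp hm hd
          _ = _ := by ring
      have h2 : 1 + m * (q : ℝ) / c ≤ 2 := by
        have : m * (q : ℝ) / c = 1 / (c * d) := by rw [hq]; field_simp
        have h3 : 1 / (c * d) ≤ 1 := by rw [div_le_one (by positivity)]; exact hcd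
        linarith
      have h4 : c / (m * (q : ℝ)) + 1 / (n * q) ≤ 2 * (c * d) := by
        have h5 : c / (m * (q : ℝ)) + 1 / (n * q) = c * d + d * (m / n) := by
          rw [hq]; field_simp
        have h6 : (m : ℝ) / n ≤ 1 := by rw [div_le_one hn]; linarith
        have h7 : d * (m / n) ≤ c * d := by nlinarith
        linarith
      calc _ ≤ 4 * (2 * (2 * (c * d)) * ((n : ℝ) ^ 2 +
            Real.exp (1 / d) * (n : ℝ) ^ (m + 1) / ((m - 1)! : ℕ))) := by gcongr
        _ = _ := by ring
    refine ⟨hrun.trans (ENNReal.ofReal_le_ofReal ?_), hsum.trans ?_,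
      hrun.trans (ENNReal.ofReal_le_ofReal ?_)⟩
    · refine mul_le_mul_of_nonneg_right ?_ (by positivity)
      exact le_mul_of_one_le_right (by positivity) (by linarith)
    · refine mul_le_mul_of_nonneg_right ?_ (by positivity)
      exact le_mul_of_one_le_left (by positivity) (by linarith)
    · calc _ ≤ 16 * (c * d) * ((1 + Real.exp (1 / d)) *
            ((n : ℝ) ^ (m + 1) / ((m - 1)! : ℕ))) := by gcongr
        _ = _ := by ring
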